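/- For a field $\mathbb{F}$ and a polynomial $P \in \mathbb{F}[x_1,\dots,x_n]$, the determinantal complexity of $P$ over $\mathbb{F}$ is the least $m \in \mathbb{N}$ for which there is an $m \times m$ matrix $M$, whose entries are polynomials in $\mathbb{F}[x_1,\dots,x_n]$ of degree at most one, such that $\det M = P$ (such an $m$ always exists). For every natural number $n \ge 6$, the determinantal complexity of $\sum_{i=1}^n x_i^n$ over $\mathbb{C}$ is at least $1.5n - 3$. The same holds over every algebraically closed field $\mathbb{F}$ of positive characteristic $p$: for every natural number $n \ge 6$ with $p \nmid n$, the determinantal complexity of $\sum_{i=1}^n x_i^n$ over $\mathbb{F}$ is at least $1.5n - 3$. -/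

import Mathlib

/-- `P` is the determinant of an `m × m` matrix whose entries are polynomials of degree at most
one. -/
def HasDetRep {σ F : Type*} [CommRing F] (P : MvPolynomial σ F) (m : ℕ) : Prop :=
  ∃ M : Matrix (Fin m) (Fin m) (MvPolynomial σ F),
    (∀ i j, (M i j).totalDegree ≤ 1) ∧ M.det = P

/-- Auxiliary form of a polynomial: `P = u A⁻¹ v` with affine entries and `A B = 1`, `det A = 1`. -/
theorem exists_affine_resolvent {σ F : Type*} [CommRing F] (P : MvPolynomial σ F) :
    ∃ (k : ℕ) (A B : Matrix (Fin k) (Fin k) (MvPolynomial σ F))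
      (u : Matrix (Fin 1) (Fin k) (MvPolynomial σ F))
      (v : Matrix (Fin k) (Fin 1) (MvPolynomial σ F)),
      (∀ i j, (A i j).totalDegree ≤ 1) ∧ (∀ i j, (u i j).totalDegree ≤ 1) ∧
      (∀ i j, (v i j).totalDegree ≤ 1) ∧ A * B = 1 ∧ A.det = 1 ∧
      u * B * v = Matrix.of fun _ _ => P := by
  induction P using MvPolynomial.induction_on with
  | C a =>
    refine ⟨1, 1, 1, 1, Matrix.of fun _ _ => MvPolynomial.C a, ?_, ?_, ?_, by simp, by simp,
      by simp⟩
    · intro i j; rw [Subsingleton.elim i j]; simp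
    · intro i j; rw [Subsingleton.elim i j]; simp
    · intro i j; simp
  | add p q hp hq =>
    obtain ⟨k, A, B, u, v, hA, hu, hv, hAB, hd, h⟩ := hp
    obtain ⟨l, A', B', u', v', hA', hu', hv', hAB', hd', h'⟩ := hq
    refine ⟨k + l,
      (Matrix.fromBlocks A 0 0 A').submatrix finSumFinEquiv.symm finSumFinEquiv.symm,
      (Matrix.fromBlocks B 0 0 B').submatrix finSumFinEquiv.symm finSumFinEquiv.symm,
      (Matrix.fromCols u u').submatrix id finSumFinEquiv.symm,
      (Matrix.fromRows v v').submatrix finSumFinEquiv.symm id, ?_, ?_, ?_, ?_, ?_, ?_⟩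
    · intro i j
      simp only [Matrix.submatrix_apply]
      rcases finSumFinEquiv.symm i with i | i <;> rcases finSumFinEquiv.symm j with j | j <;>
        simp [hA, hA']
    · intro i j
      simp only [Matrix.submatrix_apply]
      rcases finSumFinEquiv.symm j with j | j <;> simp [hu, hu']
    · intro i j
      simp only [Matrix.submatrix_apply]
      rcases finSumFinEquiv.symm i with i | i <;> simp [hv, hv']
    · rw [Matrix.submatrix_mul_equiv, Matrix.fromBlocks_multiply]
      simp [hAB, hAB']
    · rw [Matrix.det_submatrix_equiv_self, Matrix.det_fromBlocks_zero₂₁, hd, hd', one_mul]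
    · rw [Matrix.submatrix_mul_equiv, Matrix.submatrix_mul_equiv, Matrix.fromCols_mul_fromBlocks,
        Matrix.fromCols_mul_fromRows]
      simp only [Matrix.mul_zero, add_zero, zero_add, h, h']
      ext i j; simp
  | mul_X p s hp =>
    obtain ⟨k, A, B, u, v, hA, hu, hv, hAB, hd, h⟩ := hp
    refine ⟨k + 1,
      (Matrix.fromBlocks A (-v) 0 1).submatrix finSumFinEquiv.symm finSumFinEquiv.symm,
      (Matrix.fromBlocks B (B * v) 0 1).submatrix finSumFinEquiv.symm finSumFinEquiv.symm,
      (Matrix.fromCols u 0).submatrix id finSumFinEquiv.symm,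
      (Matrix.fromRows 0 (Matrix.of fun _ _ => MvPolynomial.X s)).submatrix
        finSumFinEquiv.symm id, ?_, ?_, ?_, ?_, ?_, ?_⟩
    · intro i j
      simp only [Matrix.submatrix_apply]
      rcases finSumFinEquiv.symm i with i | i <;> rcases finSumFinEquiv.symm j with j | j <;>
        simp [hA, hv, Subsingleton.elim _ (0 : Fin 1)]
    · intro i j
      simp only [Matrix.submatrix_apply]
      rcases finSumFinEquiv.symm j with j | j <;> simp [hu]
    · intro i j
      simp only [Matrix.submatrix_apply]
      rcases finSumFinEquiv.symm i with i | i
      · simp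
      · simpa [MvPolynomial.X] using
          MvPolynomial.totalDegree_monomial_le (Finsupp.single s 1) (1 : F)
    · rw [Matrix.submatrix_mul_equiv, Matrix.fromBlocks_multiply]
      simp [hAB, ← Matrix.mul_assoc]
    · rw [Matrix.det_submatrix_equiv_self, Matrix.det_fromBlocks_zero₂₁, hd]
      simp
    · rw [Matrix.submatrix_mul_equiv, Matrix.submatrix_mul_equiv, Matrix.fromCols_mul_fromBlocks,
        Matrix.fromCols_mul_fromRows]
      simp only [Matrix.mul_zero, Matrix.zero_mul, add_zero, zero_add, ← Matrix.mul_assoc, h]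
      ext i j; simp [Matrix.mul_apply]

/-- Every polynomial is the determinant of some square matrix of affine polynomials. -/
theorem exists_hasDetRep {σ F : Type*} [CommRing F] (P : MvPolynomial σ F) :
    ∃ m, HasDetRep P m := by
  obtain ⟨k, A, B, u, v, hA, hu, hv, hAB, hd, h⟩ := exists_affine_resolvent P
  refine ⟨k + 1,
    (Matrix.fromBlocks A v (-u) 0).submatrix finSumFinEquiv.symm finSumFinEquiv.symm, ?_, ?_⟩
  · intro i j
    simp only [Matrix.submatrix_apply]
    rcases finSumFinEquiv.symm i with i | i <;> rcases finSumFinEquiv.symm j with j | j <;>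
      simp [hA, hu, hv]
  · let hi : Invertible A := ⟨B, mul_eq_one_comm.mp hAB, hAB⟩
    have hB : ⅟A = B := rfl
    rw [Matrix.det_submatrix_equiv_self, Matrix.det_fromBlocks₁₁, hd, hB]
    simp [h]

open Classical in
/-- The determinantal complexity of a polynomial `P`: the least `m` such that `P` is the
determinant of an `m × m` matrix of polynomials of degree at most one. -/
noncomputable def detComplexity {σ F : Type*} [CommRing F] (P : MvPolynomial σ F) : ℕ :=
  Nat.find (exists_hasDetRep P)

/-! Let `M` be an affine matrix of size n + K with determinant P = ∑ x_i^n, and suppose n ≥ 2K + 5.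
By Jacobi's formula every ∂_i P = n x_i^(n-1) lies in the ideal of corank-one minors. If these
minors all vanished at the origin, the origin would be a minimal prime of that ideal; such primes
have height at most 4 (`Matrix.height_le_four_of_mem_minimalPrimes_adjIdeal`), but the origin has
height at least n ≥ 5. Hence M(0) has corank exactly one.

Constant transvections make M(0) diagonal with a single zero. Eliminating n - 2 of the nonzero
diagonal positions and clearing the denominator δ leaves a matrix Φ of size K + 2, with entries of
degree at most n - 1 and det Φ = δ^(K+1) P. One row and one column of Φ vanish at the origin; these
are 2K + 3 polynomials, so their common zeros have dimension at least 2 there. On this locus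
Jacobi's formula collapses to n δ^(K+1) x_i^(n-1) = ψ ∂_i Φ_oo, whose right-hand derivative has
degree at most n - 2. With t = ψ / (n δ^(K+1)) the coordinates are integral over F[t], so the
dimension is at most 1 (`MvPolynomial.not_lt_lt_of_mul_X_pow_sub_mem`), a contradiction. Taking K =
m - n gives m ≥ 3n/2 - 2. -/

/-! ### Height of the ideal of corank-one minors. -/

/-- The ideal generated by the entries of the adjugate of a square matrix, that is, by its minors of
corank one. -/
def Matrix.adjIdeal {ι A : Type*} [Fintype ι] [DecidableEq ι] [CommRing A] (M : Matrix ι ι A) :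
    Ideal A :=
  Ideal.span (Set.range fun x : ι × ι => M.adjugate x.1 x.2)

namespace Matrix

section AdjIdeal

variable {ι κ A B : Type*} [Fintype ι] [DecidableEq ι] [Fintype κ] [DecidableEq κ]
  [CommRing A] [CommRing B]

theorem adjugate_mem_adjIdeal (M : Matrix ι ι A) (i j : ι) : M.adjugate i j ∈ M.adjIdeal :=
  Ideal.subset_span ⟨(i, j), rfl⟩

theorem adjIdeal_le_iff {M : Matrix ι ι A} {I : Ideal A} :
    M.adjIdeal ≤ I ↔ ∀ i j, M.adjugate i j ∈ I := by
  rw [adjIdeal, Ideal.span_le, Set.range_subset_iff, Prod.forall]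
  rfl

theorem adjIdeal_map (f : A →+* B) (M : Matrix ι ι A) :
    (M.map f).adjIdeal = M.adjIdeal.map f := by
  rw [adjIdeal, adjIdeal, Ideal.map_span, ← Set.range_comp]
  congr 2
  funext x
  have := congrFun (congrFun (f.map_adjugate M) x.1) x.2
  simpa using this.symm

theorem adjIdeal_mul_le_left (M N : Matrix ι ι A) : (M * N).adjIdeal ≤ M.adjIdeal := by
  rw [adjIdeal_le_iff]
  intro i j
  rw [adjugate_mul_distrib, mul_apply]
  exact Ideal.sum_mem _ fun k _ => Ideal.mul_mem_left _ _ (adjugate_mem_adjIdeal _ _ _)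

theorem adjIdeal_mul_le_right (M N : Matrix ι ι A) : (M * N).adjIdeal ≤ N.adjIdeal := by
  rw [adjIdeal_le_iff]
  intro i j
  rw [adjugate_mul_distrib, mul_apply]
  exact Ideal.sum_mem _ fun k _ => Ideal.mul_mem_right _ _ (adjugate_mem_adjIdeal _ _ _)

theorem adjIdeal_mul_isUnit (M : Matrix ι ι A) {N : Matrix ι ι A} (hN : IsUnit N) :
    (M * N).adjIdeal = M.adjIdeal := by
  obtain ⟨u, rfl⟩ := hN
  refine le_antisymm (adjIdeal_mul_le_left _ _) ?_
  have := adjIdeal_mul_le_left (M * (u : Matrix ι ι A)) ((u⁻¹ : (Matrix ι ι A)ˣ) : Matrix ι ι A)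
  simpa [Matrix.mul_assoc] using this

theorem adjIdeal_isUnit_mul {M : Matrix ι ι A} (hM : IsUnit M) (N : Matrix ι ι A) :
    (M * N).adjIdeal = N.adjIdeal := by
  obtain ⟨u, rfl⟩ := hM
  refine le_antisymm (adjIdeal_mul_le_right _ _) ?_
  have := adjIdeal_mul_le_right ((u⁻¹ : (Matrix ι ι A)ˣ) : Matrix ι ι A) ((u : Matrix ι ι A) * N)
  simpa [← Matrix.mul_assoc] using this

/-- The adjugate commutes with reindexing rows and columns by the same equivalence; the discrepancy
between `e` and `f` is absorbed into a permutation matrix on the right. -/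
theorem adjIdeal_submatrix_le (M : Matrix ι ι A) (e f : κ ≃ ι) :
    (M.submatrix e f).adjIdeal ≤ M.adjIdeal := by
  have h : M.submatrix e f = (M * (1 : Matrix ι ι A).submatrix id (e.symm.trans f)).submatrix e e := by
    ext i j
    simp [Matrix.mul_apply, Matrix.one_apply]
  rw [h, adjIdeal_le_iff]
  intro i j
  rw [adjugate_submatrix_equiv_self, submatrix_apply]
  exact adjIdeal_mul_le_left _ _ (adjugate_mem_adjIdeal _ _ _)

theorem adjIdeal_submatrix (M : Matrix ι ι A) (e f : κ ≃ ι) :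
    (M.submatrix e f).adjIdeal = M.adjIdeal := by
  refine le_antisymm (adjIdeal_submatrix_le M e f) ?_
  simpa using adjIdeal_submatrix_le (M.submatrix e f) e.symm f.symm

theorem det_mem_adjIdeal [Nonempty ι] (M : Matrix ι ι A) : M.det ∈ M.adjIdeal := by
  obtain ⟨i⟩ := ‹Nonempty ι›
  rw [det_eq_sum_mul_adjugate_row M i]
  exact Ideal.sum_mem _ fun k _ => Ideal.mul_mem_left _ _ (adjugate_mem_adjIdeal _ _ _)

theorem adjugate_fromBlocks_diagonal_inr (a : Matrix Unit Unit A) (D : Matrix κ κ A) (i j : κ) :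
    (fromBlocks a 0 0 D).adjugate (Sum.inr i) (Sum.inr j) = a.det * D.adjugate i j := by
  have h : (fromBlocks a 0 0 D).updateRow (Sum.inr j) (Pi.single (Sum.inr i) 1) =
      fromBlocks a 0 0 (D.updateRow j (Pi.single i 1)) := by
    ext x y
    rcases x with x | x <;> rcases y with y | y <;>
      simp [updateRow_apply, Pi.single_apply]
  rw [adjugate_apply, h, det_fromBlocks_zero₂₁, adjugate_apply]

/-- The adjugate is block diagonal with blocks `D.det` and `a.det • D.adjugate`; the first lies in
the ideal of `D`, and `a.det` is a unit. -/
theorem adjIdeal_fromBlocks_diagonal [Nonempty κ] {a : Matrix Unit Unit A} (ha : IsUnit a.det)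
    (D : Matrix κ κ A) : (fromBlocks a 0 0 D).adjIdeal = D.adjIdeal := by
  refine le_antisymm ?_ ?_
  · rw [adjIdeal_le_iff]
    rintro (i | i) (j | j)
    · have h : (fromBlocks a 0 0 D).updateRow (Sum.inl j) (Pi.single (Sum.inl i) 1) =
          fromBlocks (a.updateRow j (Pi.single i 1)) 0 0 D := by
        ext x y
        rcases x with x | x <;> rcases y with y | y <;> simp [updateRow_apply]
      rw [adjugate_apply, h, det_fromBlocks_zero₂₁]
      exact Ideal.mul_mem_left _ _ (det_mem_adjIdeal D)
    · have h : (fromBlocks a 0 0 D).updateRow (Sum.inr j) (Pi.single (Sum.inl i) 1) =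
          fromBlocks a 0 (of fun x y => if x = j then (Pi.single i 1 : Unit → A) y else 0)
            (D.updateRow j 0) := by
        ext x y
        rcases x with x | x <;> rcases y with y | y <;>
          simp [updateRow_apply]
      rw [adjugate_apply, h, det_fromBlocks_zero₁₂, det_eq_zero_of_row_eq_zero j (by simp), mul_zero]
      exact zero_mem _
    · have h : (fromBlocks a 0 0 D).updateRow (Sum.inl j) (Pi.single (Sum.inr i) 1) =
          fromBlocks 0 (of fun _ => (Pi.single i 1 : κ → A)) 0 D := by
        ext x y
        rcases x with x | x <;> rcases y with y | y <;>
          simp [updateRow_apply, Pi.single_apply]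
      rw [adjugate_apply, h, det_fromBlocks_zero₂₁]
      simp
    · rw [adjugate_fromBlocks_diagonal_inr]
      exact Ideal.mul_mem_left _ _ (adjugate_mem_adjIdeal _ _ _)
  · rw [adjIdeal_le_iff]
    intro i j
    rw [← Ideal.unit_mul_mem_iff_mem _ ha, ← adjugate_fromBlocks_diagonal_inr]
    exact adjugate_mem_adjIdeal _ _ _

/-- Elimination of an invertible entry does not change the ideal of minors of corank one. -/
theorem exists_adjIdeal_eq_of_isUnit {k : ℕ} (hk : k ≠ 0) (M : Matrix (Fin (k + 1)) (Fin (k + 1)) A)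
    (i j : Fin (k + 1)) (h : IsUnit (M i j)) :
    ∃ N : Matrix (Fin k) (Fin k) A, M.adjIdeal = N.adjIdeal := by
  have : Nonempty (Fin k) := ⟨⟨0, Nat.pos_of_ne_zero hk⟩⟩
  let e (i : Fin (k + 1)) : Unit ⊕ Fin k ≃ Fin (k + 1) :=
    (Equiv.sumComm _ _).trans ((Equiv.optionEquivSumPUnit _).symm.trans (finSuccEquiv' i).symm)
  have he (i) : e i (Sum.inl ()) = i := by simp [e]
  set M' := M.submatrix (e i) (e j) with hM'
  have ha : IsUnit M'.toBlocks₁₁.det := by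
    simpa [det_unique, toBlocks₁₁, hM', he] using h
  let inv : Invertible M'.toBlocks₁₁ := M'.toBlocks₁₁.invertibleOfIsUnitDet ha
  -- The Schur complement of the invertible entry: block LDU factorization, with outer factors of
  -- determinant one.
  refine ⟨M'.toBlocks₂₂ - M'.toBlocks₂₁ * ⅟M'.toBlocks₁₁ * M'.toBlocks₁₂, ?_⟩
  have hfac := fromBlocks_eq_of_invertible₁₁ M'.toBlocks₁₁ M'.toBlocks₁₂ M'.toBlocks₂₁ M'.toBlocks₂₂
  rw [fromBlocks_toBlocks] at hfac
  rw [← adjIdeal_submatrix M (e i) (e j), ← hM']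
  refine (congrArg adjIdeal hfac).trans ?_
  rw [adjIdeal_mul_isUnit, adjIdeal_isUnit_mul, adjIdeal_fromBlocks_diagonal ha]
  · rw [isUnit_iff_isUnit_det, det_fromBlocks_zero₁₂]
    simp
  · rw [isUnit_iff_isUnit_det, det_fromBlocks_zero₂₁]
    simp

end AdjIdeal

theorem maximalIdeal_mem_minimalPrimes_map {A : Type*} [CommRing A] {I p : Ideal A} [p.IsPrime]
    (h : p ∈ I.minimalPrimes) :
    IsLocalRing.maximalIdeal (Localization.AtPrime p) ∈
      (I.map (algebraMap A (Localization.AtPrime p))).minimalPrimes := by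
  rw [IsLocalization.minimalPrimes_map p.primeCompl, Set.mem_preimage,
    IsLocalization.AtPrime.under_maximalIdeal _ p]
  exact h

theorem height_maximalIdeal_localization {A : Type*} [CommRing A] (p : Ideal A) [p.IsPrime] :
    (IsLocalRing.maximalIdeal (Localization.AtPrime p)).height = p.height := by
  rw [← IsLocalization.height_under p.primeCompl, IsLocalization.AtPrime.under_maximalIdeal _ p]

open Polynomial in
/-- If all entries of `M` lie in a minimal prime `p` of the ideal of its minors of corank one, then
`p[X]` is a minimal prime of the corresponding ideal of `M` with `X` added to one entry. -/
theorem map_C_mem_minimalPrimes_adjIdeal {A : Type*} [CommRing A] [IsNoetherianRing A] {k : ℕ}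
    (hk : 2 ≤ k) (M : Matrix (Fin (k + 1)) (Fin (k + 1)) A) {p : Ideal A}
    (hp : p ∈ M.adjIdeal.minimalPrimes) (hM : ∀ i j, M i j ∈ p) :
    p.map (C : A →+* A[X]) ∈ (M.map C + single 0 0 X).adjIdeal.minimalPrimes := by
  have hpp : p.IsPrime := hp.1.1
  set N := M.map (C : A →+* A[X]) + single 0 0 X with hN
  have hP : (p.map (C : A →+* A[X])).IsPrime := Ideal.isPrime_map_C_of_isPrime
  refine ⟨⟨hP, ?_⟩, ?_⟩
  · rw [adjIdeal_le_iff]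
    intro i j
    -- As the size is at least 3, each corank-one minor still involves a row other than row 0, and
    -- all entries of that row lie in `p`.
    obtain ⟨r, hr0, hrj⟩ : ∃ r : Fin (k + 1), r ≠ 0 ∧ r ≠ j := by
      have : ({0, j} : Finset (Fin (k + 1))).card < (Finset.univ : Finset (Fin (k + 1))).card := by
        have := Finset.card_le_two (a := (0 : Fin (k + 1))) (b := j)
        simp only [Finset.card_univ, Fintype.card_fin]
        omega
      obtain ⟨r, -, hr⟩ := Finset.exists_mem_notMem_of_card_lt_card this
      exact ⟨r, by simpa [not_or] using hr⟩
    rw [adjugate_apply, det_eq_sum_mul_adjugate_row _ r]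
    refine Ideal.sum_mem _ fun l _ => Ideal.mul_mem_right _ _ ?_
    rw [updateRow_ne hrj]
    simpa [hN, single_apply, hr0.symm] using Ideal.mem_map_of_mem C (hM r l)
  · rintro Q ⟨hQ, hNQ⟩ hQP
    by_contra hne
    let c : A[X] →+* A := constantCoeff
    have hmem_c : p.map (C : A →+* A[X]) ≤ p.comap c := by
      rw [Ideal.map_le_iff_le_comap, Ideal.comap_comap]
      intro a ha
      simpa [c] using ha
    -- `p.comap c` is p + (X). Setting X = 0 turns `N` back into `M`, so minimality of `p` carries
    -- over to p + (X) above Q + (X).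
    have hmin : p.comap c ∈ (Q ⊔ Ideal.span {X}).minimalPrimes := by
      refine ⟨⟨inferInstance, sup_le (hQP.trans hmem_c) ?_⟩, ?_⟩
      · simp [Ideal.span_le, c]
      · rintro q ⟨hq, hQq⟩ hqp
        have hXq : (X : A[X]) ∈ q := hQq (Ideal.mem_sup_right (Ideal.mem_span_singleton_self X))
        have hpq : p ≤ q.comap C := by
          refine hp.2 ⟨inferInstance, ?_⟩ ?_
          · rw [adjIdeal_le_iff]
            intro i j
            rw [Ideal.mem_comap]
            have hmapc : N.map c = M := by
              ext i j
              simp only [hN, c, map_apply, add_apply, single_apply, map_add]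
              split_ifs <;> simp
            have h1 : c (N.adjugate i j) = M.adjugate i j := by
              have := congrFun (congrFun (c.map_adjugate N) i) j
              simpa [hmapc] using this
            have h2 : N.adjugate i j ∈ q :=
              hQq (Ideal.mem_sup_left (hNQ (adjugate_mem_adjIdeal _ _ _)))
            have h3 := divX_mul_X_add (N.adjugate i j)
            have h4 : (C (M.adjugate i j) : A[X]) =
                N.adjugate i j - divX (N.adjugate i j) * X := by
              rw [← h1]
              simpa [c] using (eq_sub_of_add_eq' h3)
            rw [h4]
            exact q.sub_mem h2 (q.mul_mem_left _ hXq)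
          · intro a ha
            simpa [c] using hqp ha
        intro f hf
        rw [← divX_mul_X_add f]
        exact q.add_mem (q.mul_mem_left _ hXq) (hpq hf)
    -- Krull: (p + (X))/Q has height at most one, whereas Q < p[X] < p + (X) would give height two.
    have hle := Ideal.map_height_le_one_of_mem_minimalPrimes hmin
    have h1 : ((p.map C).map (Ideal.Quotient.mk Q)).IsPrime :=
      Ideal.isPrime_map_quotientMk_of_isPrime hQP
    have h2 : ((p.comap c).map (Ideal.Quotient.mk Q)).IsPrime :=
      Ideal.isPrime_map_quotientMk_of_isPrime (hQP.trans hmem_c)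
    have h3 : (⊥ : Ideal (A[X] ⧸ Q)) < (p.map C).map (Ideal.Quotient.mk Q) := by
      rw [bot_lt_iff_ne_bot, Ne, Ideal.map_eq_bot_iff_le_ker, Ideal.mk_ker]
      exact hne
    have h4 : (p.map C).map (Ideal.Quotient.mk Q) < (p.comap c).map (Ideal.Quotient.mk Q) := by
      refine lt_of_le_of_ne (Ideal.map_mono hmem_c) fun h => ?_
      have hX : Ideal.Quotient.mk Q X ∈ (p.map C).map (Ideal.Quotient.mk Q) := by
        rw [h]
        exact Ideal.mem_map_of_mem _ (by simp [c])
      rw [← Ideal.mem_comap, Ideal.comap_map_quotientMk, sup_of_le_right hQP,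
        Ideal.mem_map_C_iff] at hX
      exact hpp.ne_top ((Ideal.eq_top_iff_one _).2 (by simpa using hX 1))
    have h5 := Ideal.height_add_one_le_of_lt_of_isPrime h3
    have h6 := Ideal.height_add_one_le_of_lt_of_isPrime h4
    have h7 : (1 : ℕ∞) + 1 ≤ 1 :=
      (add_le_add_left (le_add_self.trans h5) 1).trans (h6.trans hle)
    exact absurd h7 (by decide)

/-- Every minimal prime of the ideal of minors of corank one has height at most four. -/
theorem height_le_four_of_mem_minimalPrimes_adjIdeal (k : ℕ) :
    ∀ {A : Type*} [CommRing A] [IsNoetherianRing A] (M : Matrix (Fin k) (Fin k) A) {p : Ideal A},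
      p ∈ M.adjIdeal.minimalPrimes → p.height ≤ 4 := by
  induction k with
  | zero =>
    intro A _ _ M p hp
    refine (Ideal.height_le_card_of_mem_minimalPrimes_span (Set.finite_range _) hp).trans ?_
    simp [Set.range_eq_empty]
  | succ k ih =>
    intro A _ _ M p hp
    obtain hk | hk := Nat.lt_or_ge k 2
    · refine (Ideal.height_le_card_of_mem_minimalPrimes_span (Set.finite_range _) hp).trans ?_
      have h := Set.ncard_image_le (f := fun x : Fin (k + 1) × Fin (k + 1) =>
        M.adjugate x.1 x.2) Set.finite_univ
      rw [Set.image_univ, Set.ncard_univ, Nat.card_eq_fintype_card] at h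
      simp only [Fintype.card_prod, Fintype.card_fin] at h
      have : (k + 1) * (k + 1) ≤ 4 := by nlinarith
      exact_mod_cast h.trans this
    · have unitCase : ∀ {B : Type _} [CommRing B] [IsNoetherianRing B]
          (N : Matrix (Fin (k + 1)) (Fin (k + 1)) B) {q : Ideal B},
          q ∈ N.adjIdeal.minimalPrimes → ∀ i j, N i j ∉ q → q.height ≤ 4 := by
        intro B _ _ N q hq i j hij
        have hqp : q.IsPrime := hq.1.1
        let φ := algebraMap B (Localization.AtPrime q)
        have h1 := maximalIdeal_mem_minimalPrimes_map hq
        rw [← adjIdeal_map] at h1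
        obtain ⟨N', hN'⟩ := exists_adjIdeal_eq_of_isUnit (by omega) (N.map φ) i j
          ((IsLocalization.AtPrime.isUnit_to_map_iff (Localization.AtPrime q) q (N i j)).2 hij)
        rw [hN'] at h1
        rw [← height_maximalIdeal_localization]
        exact ih N' h1
      have hpp : p.IsPrime := hp.1.1
      by_cases hM : ∃ i j, M i j ∉ p
      · obtain ⟨i, j, hij⟩ := hM
        exact unitCase M hp i j hij
      · push Not at hM
        let φ := algebraMap A (Localization.AtPrime p)
        have h1 := maximalIdeal_mem_minimalPrimes_map hp
        rw [← adjIdeal_map] at h1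
        have h2 : ∀ i j, (M.map φ) i j ∈ IsLocalRing.maximalIdeal (Localization.AtPrime p) := by
          intro i j
          rw [← Localization.AtPrime.map_eq_maximalIdeal]
          exact Ideal.mem_map_of_mem _ (hM i j)
        -- Adding X to an entry preserves minimality and height, and the new entry is outside p[X],
        -- its X-coefficient being 1; the case of a unit entry then applies.
        have h3 := map_C_mem_minimalPrimes_adjIdeal hk _ h1 h2
        rw [← height_maximalIdeal_localization,
          ← Polynomial.height_map_C (IsLocalRing.maximalIdeal (Localization.AtPrime p))]
        refine unitCase _ h3 0 0 fun h => ?_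
        rw [Ideal.mem_map_C_iff] at h
        have := h 1
        simp at this

end Matrix

/-! ### Jacobi's formula for derivations. -/

namespace Derivation

variable {R A : Type*} [CommRing R] [CommRing A] [Algebra R A]

theorem map_prod_eq_sum {ι : Type*} [DecidableEq ι] (d : Derivation R A A) (s : Finset ι)
    (f : ι → A) : d (∏ i ∈ s, f i) = ∑ i ∈ s, (∏ j ∈ s.erase i, f j) * d (f i) := by
  induction s using Finset.induction_on with
  | empty => simp
  | insert a s ha ih =>
    rw [Finset.prod_insert ha, Derivation.leibniz, ih, Finset.sum_insert ha,
      Finset.erase_insert ha, add_comm]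
    simp only [smul_eq_mul, Finset.mul_sum]
    congr 1
    refine Finset.sum_congr rfl fun i hi => ?_
    rw [Finset.erase_insert_of_ne (by rintro rfl; exact ha hi),
      Finset.prod_insert (fun h => ha (Finset.mem_of_mem_erase h)), mul_assoc]

/-- Jacobi's formula. -/
theorem map_det {ι : Type*} [Fintype ι] [DecidableEq ι] (d : Derivation R A A)
    (M : Matrix ι ι A) : d M.det = ∑ i, ∑ k, M.adjugate i k * d (M k i) := by
  have h (i : ι) : ∑ k, M.adjugate i k * d (M k i) =
      (M.updateCol i fun k => d (M k i)).det := by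
    rw [← Matrix.cramer_apply, Matrix.cramer_eq_adjugate_mulVec]
    rfl
  simp_rw [h, Matrix.det_apply, map_sum]
  rw [Finset.sum_comm]
  refine Finset.sum_congr rfl fun σ _ => ?_
  rw [← Finset.smul_sum, Units.smul_def, map_zsmul, ← Units.smul_def, map_prod_eq_sum]
  congr 1
  refine Finset.sum_congr rfl fun i _ => ?_
  rw [← Finset.mul_prod_erase _ _ (Finset.mem_univ i), Matrix.updateCol_self, mul_comm]
  congr 1
  refine Finset.prod_congr rfl fun j hj => ?_
  rw [Matrix.updateCol_ne (Finset.ne_of_mem_erase hj)]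

end Derivation

/-! ### Height of the origin, degrees of derivatives, and integrality. -/

namespace MvPolynomial

variable {F : Type*} [Field F]

/-- The ideal of polynomials vanishing at the origin has height at least the number of variables. -/
theorem le_height_ker_constantCoeff (n : ℕ) :
    (n : ℕ∞) ≤ (RingHom.ker (constantCoeff : MvPolynomial (Fin n) F →+* F)).height := by
  -- `φ k` kills the first `k` variables; the kernels form a strict chain of primes.
  let φ (k : ℕ) : MvPolynomial (Fin n) F →ₐ[F] MvPolynomial (Fin n) F :=
    aeval fun i => if (i : ℕ) < k then 0 else X i
  have hφ (k l : ℕ) (hkl : k ≤ l) : (φ l).comp (φ k) = φ l := by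
    ext1 i
    simp only [φ, AlgHom.comp_apply, aeval_X]
    split_ifs with h1 h2 h2
    · simp
    · omega
    · simp [h2]
    · simp [h2]
  have key (k : ℕ) (hk : k ≤ n) : (k : ℕ∞) ≤ (RingHom.ker (φ k).toRingHom).height := by
    induction k with
    | zero => simp
    | succ k ih =>
      have h1 : (RingHom.ker (φ k).toRingHom).IsPrime := RingHom.ker_isPrime _
      have h2 : (RingHom.ker (φ (k + 1)).toRingHom).IsPrime := RingHom.ker_isPrime _
      have hle : RingHom.ker (φ k).toRingHom ≤ RingHom.ker (φ (k + 1)).toRingHom := by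
        intro f hf
        have h0 : φ k f = 0 := hf
        have := DFunLike.congr_fun (hφ k (k + 1) (Nat.le_succ k)) f
        rw [AlgHom.comp_apply, h0, map_zero] at this
        exact this.symm
      have hlt : RingHom.ker (φ k).toRingHom < RingHom.ker (φ (k + 1)).toRingHom := by
        refine lt_of_le_not_ge hle fun h => ?_
        have hX : (X ⟨k, hk⟩ : MvPolynomial (Fin n) F) ∈ RingHom.ker (φ (k + 1)).toRingHom := by
          change φ (k + 1) (X ⟨k, hk⟩) = 0
          simp [φ]
        have : φ k (X ⟨k, hk⟩) = 0 := h hX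
        simp [φ] at this
      have := Ideal.height_add_one_le_of_lt_of_isPrime hlt
      push_cast
      exact (add_le_add_left (ih (by omega)) 1).trans this
  refine (key n le_rfl).trans (Ideal.height_mono fun f hf => ?_)
  have h0 : φ n f = 0 := hf
  have h1 : (aeval (0 : Fin n → F)).comp (φ n) = aeval (0 : Fin n → F) := by
    ext1 i
    simp [φ]
  have h2 := DFunLike.congr_fun h1 f
  rw [AlgHom.comp_apply, h0, map_zero] at h2
  rw [RingHom.mem_ker]
  simpa [aeval_zero] using h2.symm

theorem totalDegree_pderiv_le {σ R : Type*} [CommSemiring R] (i : σ) (p : MvPolynomial σ R) :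
    (pderiv i p).totalDegree ≤ p.totalDegree - 1 := by
  refine Finset.sup_le fun m hm => ?_
  rw [mem_support_iff, coeff_pderiv] at hm
  have h := le_totalDegree (mem_support_iff.2 (left_ne_zero_of_mul hm))
  have h2 : ((m + Finsupp.single i 1).sum fun _ e => e) = (m.sum fun _ e => e) + 1 := by
    rw [Finsupp.sum_add_index' (by simp) (by simp), Finsupp.sum_single_index rfl]
  omega

/-- If the elements `x i` of an `R`-algebra satisfy `x i ^ e = r i (x)` with `r i` of total degree
less than `e`, then they are integral over `R`. -/
theorem isIntegral_of_pow_eq_aeval {R B σ : Type*} [CommRing R] [CommRing B] [Algebra R B]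
    [Finite σ] {e : ℕ} (x : σ → B) (r : σ → MvPolynomial σ R)
    (hr : ∀ i, (r i).totalDegree < e) (hx : ∀ i, x i ^ e = aeval x (r i)) (i : σ) :
    IsIntegral R (x i) := by
  classical
  have : Fintype σ := Fintype.ofFinite σ
  let mon (a : σ →₀ ℕ) : B := a.prod fun i k => x i ^ k
  have hmon (a : σ →₀ ℕ) : aeval x (monomial a (1 : R)) = mon a := by simp [aeval_monomial, mon]
  have hmon_add (a b : σ →₀ ℕ) : mon (a + b) = mon a * mon b := by
    rw [← hmon, ← hmon, ← hmon, ← map_mul, monomial_mul, one_mul]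
  let s : Set (σ →₀ ℕ) := {a | ∀ i, a i < e}
  have hs : s.Finite := by
    refine (Set.finite_Iic (Finsupp.equivFunOnFinite.symm fun _ : σ => e)).subset fun a ha => ?_
    intro i
    simpa using (ha i).le
  let N : Submodule R B := Submodule.span R (mon '' s)
  -- Replacing a factor `x i ^ e` by `r i` strictly lowers the degree, so the finitely many
  -- monomials with all exponents below `e` span.
  have hmem (d : ℕ) : ∀ a : σ →₀ ℕ, a.degree = d → mon a ∈ N := by
    induction d using Nat.strong_induction_on with
    | _ d ih =>
      intro a ha
      by_cases has : a ∈ s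
      · exact Submodule.subset_span ⟨a, has, rfl⟩
      · obtain ⟨i, hi⟩ : ∃ i, e ≤ a i := by simpa [s] using has
        have hsub : Finsupp.single i e ≤ a := by simpa using hi
        obtain ⟨b, rfl⟩ := exists_add_of_le hsub
        have h1 : mon (Finsupp.single i e) = aeval x (r i) := by 
          rw [← hx]
          exact Finsupp.prod_single_index (pow_zero _)
        rw [hmon_add, h1, (r i).as_sum, map_sum, Finset.sum_mul]
        refine Submodule.sum_mem _ fun c hc => ?_
        have h2 : aeval x (monomial c (coeff c (r i))) = coeff c (r i) • mon c := by
          rw [← hmon, ← map_smul, smul_monomial, smul_eq_mul, mul_one]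
        rw [h2, smul_mul_assoc, ← hmon_add]
        refine N.smul_mem _ (ih _ ?_ _ rfl)
        have h3 : c.degree ≤ (r i).totalDegree := le_totalDegree hc
        have h4 := hr i
        rw [map_add, Finsupp.degree_single] at ha
        rw [map_add]
        omega
  have hN : N.FG := Submodule.fg_span (hs.image _)
  have htop : Subalgebra.toSubmodule (aeval x : MvPolynomial σ R →ₐ[R] B).range ≤ N := by
    rintro _ ⟨f, rfl⟩
    change aeval x f ∈ N
    rw [f.as_sum, map_sum]
    refine Submodule.sum_mem _ fun c _ => ?_
    have h2 : aeval x (monomial c (coeff c f)) = coeff c f • mon c := by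
      rw [← hmon, ← map_smul, smul_monomial, smul_eq_mul, mul_one]
    rw [h2]
    exact N.smul_mem _ (hmem _ c rfl)
  have hbot : N ≤ Subalgebra.toSubmodule (aeval x : MvPolynomial σ R →ₐ[R] B).range := by
    refine Submodule.span_le.2 ?_
    rintro _ ⟨a, -, rfl⟩
    exact ⟨monomial a 1, hmon a⟩
  refine IsIntegral.of_mem_of_fg (aeval x : MvPolynomial σ R →ₐ[R] B).range ?_ _ ⟨X i, by simp⟩
  rw [le_antisymm htop hbot]
  exact hN

end MvPolynomial

/-! ### Chains of primes and the dimension bound. -/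

/-- Passing to the quotient by `s` lowers the height of `m` by at most the number of elements of
`s`, so height two remains; a chain found there is pulled back. -/
theorem Ideal.exists_lt_lt_of_encard_add_two_le_height {A : Type*} [CommRing A]
    [IsNoetherianRing A] {m : Ideal A} [m.IsPrime] (s : Set A) (hs : s ⊆ m)
    (h : s.encard + 2 ≤ m.height) (hfin : s.Finite) :
    ∃ p q : Ideal A, p.IsPrime ∧ q.IsPrime ∧ span s ≤ p ∧ p < q ∧ q < m := by
  have hI : span s ≤ m := span_le.2 hs
  have hm : (m.map (Quotient.mk (span s))).IsPrime := isPrime_map_quotientMk_of_isPrime hI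
  have h2 : (2 : ℕ∞) ≤ (m.map (Quotient.mk (span s))).height := by
    have := h.trans (height_le_height_add_encard_of_subset s hs)
    rw [add_comm] at this
    exact (ENat.add_le_add_iff_right hfin.encard_lt_top.ne).1 this
  have h3 : ¬ (m.map (Quotient.mk (span s))).height ≤ (1 : ℕ) := by
    intro h4
    exact absurd (h2.trans h4) (by decide)
  rw [height_le_iff] at h3
  push Not at h3
  obtain ⟨q, hq, hqm, hq1⟩ := h3
  have h4 : ¬ q.height ≤ (0 : ℕ) := by
    intro h4
    exact absurd (hq1.trans h4) (by decide)
  rw [height_le_iff] at h4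
  push Not at h4
  obtain ⟨p, hp, hpq, -⟩ := h4
  have hmono : StrictMono (comap (Quotient.mk (span s))) :=
    Monotone.strictMono_of_injective (fun _ _ h => comap_mono h)
      (comap_injective_of_surjective _ Quotient.mk_surjective)
  refine ⟨p.comap (Quotient.mk (span s)), q.comap (Quotient.mk (span s)), inferInstance,
    inferInstance, ?_, hmono hpq, ?_⟩
  · conv_lhs => rw [← mk_ker (I := span s)]
    exact ker_le_comap _
  · have := hmono hqm
    rwa [comap_map_quotientMk, sup_of_le_right hI] at this

namespace MvPolynomial

/-- The relations make the image of `φ` integral over F[t]; by incomparability, a strict inclusion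
witnessed in that image stays strict after contraction to F[t]. -/
theorem comap_aeval_lt_comap_aeval {F σ B : Type*} [Field F] [Finite σ] [CommRing B] [Algebra F B]
    (φ : MvPolynomial σ F →ₐ[F] B) (t : B) {e : ℕ} (r : σ → MvPolynomial σ F)
    (hr : ∀ i, (r i).totalDegree < e) (hrel : ∀ i, φ (X i) ^ e = t * φ (r i)) {I J : Ideal B}
    [I.IsPrime] (hIJ : I ≤ J) (f : MvPolynomial σ F) (hfJ : φ f ∈ J) (hfI : φ f ∉ I) :
    I.comap (Polynomial.aeval (R := F) t) < J.comap (Polynomial.aeval (R := F) t) := by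
  let alg : Algebra (Polynomial F) B := (Polynomial.aeval (R := F) t).toRingHom.toAlgebra
  have halg (f : Polynomial F) : algebraMap (Polynomial F) B f = Polynomial.aeval t f := rfl
  have hcomp (f : MvPolynomial σ F) : aeval (fun i => φ (X i)) (map Polynomial.C f) = φ f := by
    rw [aeval_def, eval₂_map]
    have h1 : (algebraMap (Polynomial F) B).comp Polynomial.C = algebraMap F B := by
      ext a
      simp [halg]
    rw [h1, ← aeval_def]
    exact DFunLike.congr_fun (aeval_unique φ).symm f
  have hint (i : σ) : IsIntegral (Polynomial F) (φ (X i)) := by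
    -- `t` is treated as a scalar from F[T], so the factor it contributes does not raise the degree
    -- in the variables.
    refine isIntegral_of_pow_eq_aeval (e := e) (fun i => φ (X i))
      (fun i => C Polynomial.X * map Polynomial.C (r i)) (fun i => ?_) (fun i => ?_) i
    · refine (totalDegree_mul _ _).trans_lt ?_
      rw [totalDegree_C, zero_add]
      exact (Finset.sup_mono (support_map_subset _ _)).trans_lt (hr i)
    · rw [map_mul, hcomp, aeval_C, halg, Polynomial.aeval_X, hrel]
  have hint' (f : MvPolynomial σ F) : IsIntegral (Polynomial F) (φ f) := by
    induction f using MvPolynomial.induction_on with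
    | C a =>
      have : φ (C a) = algebraMap (Polynomial F) B (Polynomial.C a) := by
        rw [halg, Polynomial.aeval_C]
        exact φ.commutes a
      rw [this]
      exact isIntegral_algebraMap
    | add f g hf hg => rw [map_add]; exact hf.add hg
    | mul_X f i hf => rw [map_mul]; exact hf.mul (hint i)
  exact Ideal.comap_lt_comap_of_integral_mem_sdiff hIJ ⟨hfJ, hfI⟩ (hint' f)

/-- The relations `δ * X i ^ e = ψ * r i` with `r i` of total degree less than `e` define a subscheme
of dimension at most one on the locus where `δ` does not vanish. -/
theorem not_lt_lt_of_mul_X_pow_sub_mem {F σ : Type*} [Field F] [Finite σ]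
    {p q m : Ideal (MvPolynomial σ F)} [hp : p.IsPrime] [hq : q.IsPrime] [hm : m.IsPrime]
    (hpq : p < q) (hqm : q < m) {δ ψ : MvPolynomial σ F} (hδ : δ ∉ m) {e : ℕ}
    (r : σ → MvPolynomial σ F) (hr : ∀ i, (r i).totalDegree < e)
    (h : ∀ i, δ * X i ^ e - ψ * r i ∈ p) : False := by
  -- Localizing at `m` inverts `δ`, so that t = ψ/δ exists, and keeps the chain p < q < m.
  let L := Localization.AtPrime m
  let pL : Ideal L := p.map (algebraMap _ L)
  let φ : MvPolynomial σ F →ₐ[F] L ⧸ pL :=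
    (Ideal.Quotient.mkₐ F pL).comp (IsScalarTower.toAlgHom F (MvPolynomial σ F) L)
  have hφ (f) : φ f = Ideal.Quotient.mk pL (algebraMap _ L f) := rfl
  have hle {a : Ideal (MvPolynomial σ F)} (ha : p ≤ a) : pL ≤ a.map (algebraMap _ L) :=
    Ideal.map_mono ha
  have hdisj {a : Ideal (MvPolynomial σ F)} (ha : a ≤ m) :
      Disjoint (m.primeCompl : Set (MvPolynomial σ F)) a :=
    Set.disjoint_left.2 fun x hx hxa => hx (ha hxa)
  let J (a : Ideal (MvPolynomial σ F)) : Ideal (L ⧸ pL) :=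
    (a.map (algebraMap _ L)).map (Ideal.Quotient.mk pL)
  have hJprime (a : Ideal (MvPolynomial σ F)) [a.IsPrime] (hpa : p ≤ a) (ham : a ≤ m) :
      (J a).IsPrime := by
    have := IsLocalization.isPrime_of_isPrime_disjoint m.primeCompl L a ‹_› (hdisj ham)
    exact Ideal.isPrime_map_quotientMk_of_isPrime (hle hpa)
  have hJmem (a : Ideal (MvPolynomial σ F)) [a.IsPrime] (hpa : p ≤ a) (ham : a ≤ m) (f) :
      φ f ∈ J a ↔ f ∈ a := by
    rw [hφ, ← Ideal.mem_comap, Ideal.comap_map_quotientMk, sup_of_le_right (hle hpa),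
      ← Ideal.mem_comap, ← Ideal.under_def,
      IsLocalization.under_map_of_isPrime_disjoint m.primeCompl L ‹_› (hdisj ham)]
  have hJmono {a b : Ideal (MvPolynomial σ F)} (hab : a ≤ b) : J a ≤ J b :=
    Ideal.map_mono (Ideal.map_mono hab)
  have hδu : IsUnit (φ δ) :=
    ((IsLocalization.AtPrime.isUnit_to_map_iff L m δ).2 hδ).map (Ideal.Quotient.mk pL)
  obtain ⟨u, hu⟩ := hδu
  let t : L ⧸ pL := ↑u⁻¹ * φ ψ
  have hrel (i : σ) : φ (X i) ^ e = t * φ (r i) := by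
    have h0 : φ (δ * X i ^ e - ψ * r i) = 0 := by
      rw [hφ, Ideal.Quotient.eq_zero_iff_mem]
      exact Ideal.mem_map_of_mem _ (h i)
    rw [map_sub, map_mul, map_mul, map_pow, sub_eq_zero, ← hu] at h0
    rw [mul_assoc, ← h0, Units.inv_mul_cancel_left]
  have hlt {a b : Ideal (MvPolynomial σ F)} [a.IsPrime] [b.IsPrime] (hpa : p ≤ a) (hab : a < b)
      (hbm : b ≤ m) : (J a).comap (Polynomial.aeval (R := F) t) <
        (J b).comap (Polynomial.aeval (R := F) t) := by
    obtain ⟨f, hfb, hfa⟩ := SetLike.exists_of_lt hab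
    have := hJprime a hpa (hab.le.trans hbm)
    refine comap_aeval_lt_comap_aeval φ t r hr hrel (hJmono hab.le) f ?_ ?_
    · exact (hJmem b (hpa.trans hab.le) hbm f).2 hfb
    · exact fun h => hfa ((hJmem a hpa (hab.le.trans hbm) f).1 h)
  have h1 := hlt le_rfl hpq hqm.le
  have h2 := hlt hpq.le hqm le_rfl
  have hq' := hJprime q hpq.le hqm.le
  have hm' := hJprime m (hpq.trans hqm).le le_rfl
  -- The chain contracts to a strict chain of three primes in F[T], where nonzero primes are
  -- maximal.
  have hmax : ((J q).comap (Polynomial.aeval (R := F) t)).IsMaximal :=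
    Ideal.IsPrime.isMaximal_of_ne_bot inferInstance (ne_bot_of_gt h1)
  exact h2.ne (hmax.eq_of_le (Ideal.IsPrime.ne_top inferInstance) h2.le)

end MvPolynomial

/-! ### Corank of the matrix at the origin. -/

open MvPolynomial

section PowerSum

variable {F : Type*} [Field F] {n : ℕ}

theorem pderiv_sum_X_pow (i : Fin n) :
    pderiv i (∑ j : Fin n, (X j : MvPolynomial (Fin n) F) ^ n) = C (n : F) * X i ^ (n - 1) := by
  rw [map_sum, Finset.sum_eq_single i]
  · simp [Derivation.leibniz_pow]
  · intro j _ hj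
    simp [Derivation.leibniz_pow, pderiv_X_of_ne hj]
  · simp

/-- The value at the origin of a matrix whose determinant is the power sum has corank at most one. -/
theorem adjugate_map_constantCoeff_ne_zero {m : ℕ} (hn : 5 ≤ n) (hF : (n : F) ≠ 0)
    (M : Matrix (Fin m) (Fin m) (MvPolynomial (Fin n) F)) (hdet : M.det = ∑ i, X i ^ n) :
    (M.map constantCoeff).adjugate ≠ 0 := by
  intro h0
  have hprime : (RingHom.ker (constantCoeff : MvPolynomial (Fin n) F →+* F)).IsPrime :=
    RingHom.ker_isPrime _
  have hmin : RingHom.ker (constantCoeff : MvPolynomial (Fin n) F →+* F) ∈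
      M.adjIdeal.minimalPrimes := by
    refine ⟨⟨hprime, ?_⟩, ?_⟩
    · rw [Matrix.adjIdeal_le_iff]
      intro i j
      have := congrFun (congrFun (RingHom.map_adjugate constantCoeff M) i) j
      rw [RingHom.mem_ker]
      simpa [h0] using this
    · rintro q ⟨hq, hMq⟩ -
      have hX (i : Fin n) : X i ∈ q := by
        -- By Jacobi's formula the partial derivatives of the determinant lie in the ideal of
        -- minors, hence in `q`.
        have h1 : C (n : F) * X i ^ (n - 1) ∈ q := by
          rw [← pderiv_sum_X_pow, ← hdet, Derivation.map_det]
          exact q.sum_mem fun j _ => q.sum_mem fun k _ =>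
            q.mul_mem_right _ (hMq (Matrix.adjugate_mem_adjIdeal _ _ _))
        have h2 : IsUnit (C (n : F) : MvPolynomial (Fin n) F) := (isUnit_iff_ne_zero.2 hF).map C
        exact hq.mem_of_pow_mem _ ((q.unit_mul_mem_iff_mem h2).1 h1)
      intro f hf
      have h3 : Ideal.Quotient.mk q f = algebraMap F _ (constantCoeff f) := by
        have : (Ideal.Quotient.mkₐ F q).comp (aeval X) =
            (Algebra.ofId F (MvPolynomial (Fin n) F ⧸ q)).comp (aeval (0 : Fin n → F)) := by
          ext1 i
          simpa using Ideal.Quotient.eq_zero_iff_mem.2 (hX i)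
        have := DFunLike.congr_fun this f
        simpa [aeval_zero, Algebra.ofId_apply] using this
      rw [RingHom.mem_ker.1 hf, map_zero] at h3
      exact Ideal.Quotient.eq_zero_iff_mem.1 h3
  have h1 := (le_height_ker_constantCoeff (F := F) n).trans
    (Matrix.height_le_four_of_mem_minimalPrimes_adjIdeal m M hmin)
  have h2 : n ≤ 4 := by exact_mod_cast h1
  omega

end PowerSum

/-! ### Degrees of minors, Schur complements, and determinants modulo a row and a column. -/

namespace Matrix

section Degree

variable {σ R : Type*} [CommRing R] {ι : Type*} [Fintype ι] [DecidableEq ι]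

theorem totalDegree_det_le (M : Matrix ι ι (MvPolynomial σ R)) (w : ι → ℕ)
    (h : ∀ i j, (M i j).totalDegree ≤ w i) : M.det.totalDegree ≤ ∑ i, w i := by
  rw [det_apply]
  refine (totalDegree_finsetSum _ _).trans (Finset.sup_le fun τ _ => ?_)
  have h1 : (∏ i, M (τ i) i).totalDegree ≤ ∑ i, w i := by
    refine (totalDegree_finsetProd _ _).trans ?_
    rw [← Equiv.sum_comp τ w]
    exact Finset.sum_le_sum fun i _ => h _ _
  rcases Int.units_eq_one_or (Equiv.Perm.sign τ) with hs | hs <;> rw [hs]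
  · simpa using h1
  · simpa using h1

theorem totalDegree_adjugate_le (M : Matrix ι ι (MvPolynomial σ R))
    (h : ∀ i j, (M i j).totalDegree ≤ 1) (i j : ι) :
    (M.adjugate i j).totalDegree ≤ Fintype.card ι - 1 := by
  rw [adjugate_apply]
  -- The replaced row is constant, hence weight 0; every other row has weight 1.
  refine (totalDegree_det_le _ (fun k => if k = j then 0 else 1) fun k l => ?_).trans ?_
  · by_cases hk : k = j
    · subst hk
      by_cases hl : l = i
      · subst hl
        simp
      · simp [hl]
    · simpa [hk] using h k l
  · simp [Finset.sum_ite, Finset.filter_ne', Finset.card_erase_of_mem]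

end Degree

section Schur

variable {α κ A : Type*} [Fintype κ] [DecidableEq κ] [CommRing A]

/-- The Schur complement of the lower right block, multiplied by the determinant of that block. -/
def schurNumerator (M : Matrix (α ⊕ κ) (α ⊕ κ) A) : Matrix α α A :=
  M.toBlocks₂₂.det • M.toBlocks₁₁ - M.toBlocks₁₂ * M.toBlocks₂₂.adjugate * M.toBlocks₂₁

/-- A block column operation of determinant δ^|α| clears the lower left block, where δ is the
determinant of the lower right one. No invertibility is needed because δ is cancelled on neither
side. -/
theorem det_schurNumerator_mul [Fintype α] [DecidableEq α] (M : Matrix (α ⊕ κ) (α ⊕ κ) A) :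
    M.schurNumerator.det * M.toBlocks₂₂.det = M.det * M.toBlocks₂₂.det ^ Fintype.card α := by
  have h : M * fromBlocks (M.toBlocks₂₂.det • 1) 0 (-(M.toBlocks₂₂.adjugate * M.toBlocks₂₁)) 1 =
      fromBlocks M.schurNumerator M.toBlocks₁₂ 0 M.toBlocks₂₂ := by
    conv_lhs => rw [← fromBlocks_toBlocks M]
    rw [fromBlocks_multiply]
    congr 1
    · simp [schurNumerator, sub_eq_add_neg, Matrix.mul_assoc]
    · simp
    · simp [← Matrix.mul_assoc, mul_adjugate]
    · simp
  have h2 := congrArg det h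
  rw [det_mul, det_fromBlocks_zero₁₂, det_fromBlocks_zero₂₁, det_smul, det_one, det_one] at h2
  simpa using h2.symm

theorem totalDegree_schurNumerator_le {σ R : Type*} [CommRing R]
    (M : Matrix (α ⊕ κ) (α ⊕ κ) (MvPolynomial σ R)) (h : ∀ i j, (M i j).totalDegree ≤ 1)
    (hκ : 1 ≤ Fintype.card κ) (i j : α) :
    (M.schurNumerator i j).totalDegree ≤ Fintype.card κ + 1 := by
  have hD : ∀ i j, (M.toBlocks₂₂ i j).totalDegree ≤ 1 := fun i j => h _ _
  have hdet : M.toBlocks₂₂.det.totalDegree ≤ Fintype.card κ := by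
    simpa using totalDegree_det_le M.toBlocks₂₂ (fun _ => 1) hD
  rw [schurNumerator, sub_apply, smul_apply, smul_eq_mul]
  refine (totalDegree_sub _ _).trans (max_le ?_ ?_)
  · exact (totalDegree_mul _ _).trans (add_le_add hdet (h _ _))
  · rw [mul_apply]
    refine totalDegree_finsetSum_le fun k _ => ?_
    refine (totalDegree_mul _ _).trans ?_
    refine add_le_add ?_ (h _ _)
    rw [mul_apply]
    refine totalDegree_finsetSum_le fun l _ => ?_
    refine (totalDegree_mul _ _).trans ?_
    have h1 := totalDegree_adjugate_le _ hD l k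
    have h2 : (M.toBlocks₁₂ i l).totalDegree ≤ 1 := h _ _
    omega

theorem schurNumerator_mem_of_row {I : Ideal A} {M : Matrix (α ⊕ κ) (α ⊕ κ) A} {i : α}
    (h : ∀ j, M (Sum.inl i) j ∈ I) (j : α) : M.schurNumerator i j ∈ I := by
  rw [schurNumerator, sub_apply, smul_apply, smul_eq_mul, mul_apply]
  refine I.sub_mem (I.mul_mem_left _ (h _)) (I.sum_mem fun k _ => I.mul_mem_right _ ?_)
  rw [mul_apply]
  exact I.sum_mem fun l _ => I.mul_mem_right _ (h _)

theorem schurNumerator_mem_of_col {I : Ideal A} {M : Matrix (α ⊕ κ) (α ⊕ κ) A} {j : α}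
    (h : ∀ i, M i (Sum.inl j) ∈ I) (i : α) : M.schurNumerator i j ∈ I := by
  rw [schurNumerator, sub_apply, smul_apply, smul_eq_mul, mul_apply]
  exact I.sub_mem (I.mul_mem_left _ (h _)) (I.sum_mem fun k _ => I.mul_mem_left _ (h _))

end Schur

section RowCol

variable {ι A : Type*} [Fintype ι] [DecidableEq ι] [CommRing A]

theorem det_mem_of_row_mem {I : Ideal A} {M : Matrix ι ι A} {o : ι} (h : ∀ j, M o j ∈ I) :
    M.det ∈ I := by
  rw [det_eq_sum_mul_adjugate_row M o]
  exact I.sum_mem fun k _ => I.mul_mem_right _ (h k)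

theorem adjugate_mem_of_row_mem {I : Ideal A} {M : Matrix ι ι A} {o : ι} (h : ∀ j, M o j ∈ I)
    {i j : ι} (hj : j ≠ o) : M.adjugate i j ∈ I := by
  rw [adjugate_apply]
  refine det_mem_of_row_mem (o := o) fun k => ?_
  rw [updateRow_ne hj.symm]
  exact h k

theorem adjugate_mem_of_col_mem {I : Ideal A} {M : Matrix ι ι A} {o : ι} (h : ∀ i, M i o ∈ I)
    {i j : ι} (hi : i ≠ o) : M.adjugate i j ∈ I := by
  have := adjugate_mem_of_row_mem (M := Mᵀ) (I := I) (o := o) h (i := j) hi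
  rwa [← adjugate_transpose] at this

/-- Modulo an ideal containing a row and a column of `M`, a derivative of `det M` only involves the
derivative of the entry where they meet. -/
theorem derivation_det_sub_mem {R : Type*} [CommRing R] [Algebra R A] (d : Derivation R A A)
    {I : Ideal A} {M : Matrix ι ι A} {o : ι} (hrow : ∀ j, M o j ∈ I) (hcol : ∀ i, M i o ∈ I) :
    d M.det - M.adjugate o o * d (M o o) ∈ I := by
  rw [d.map_det, ← Finset.add_sum_erase _ _ (Finset.mem_univ o),
    ← Finset.add_sum_erase _ _ (Finset.mem_univ o), add_assoc, add_sub_cancel_left]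
  -- Every cofactor other than the one at (o, o) retains row `o` or column `o`, so it lies in `I`.
  refine I.add_mem (I.sum_mem fun k hk => I.mul_mem_right _ ?_)
    (I.sum_mem fun i hi => I.sum_mem fun k _ => I.mul_mem_right _ ?_)
  · exact adjugate_mem_of_row_mem hrow (Finset.ne_of_mem_erase hk)
  · exact adjugate_mem_of_col_mem hcol (Finset.ne_of_mem_erase hi)

end RowCol

end Matrix

/-! ### The lower bound for power sums. -/

section LowerBound

variable {F : Type*} [Field F] {n : ℕ}

/-- A matrix of affine polynomials whose determinant is the power sum cannot vanish at the origin on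
the row and the column of some index while having an invertible disjoint block of size `n - 2`, if
its size is too small. -/
theorem false_of_det_eq_sum_X_pow {K : ℕ} (hn : 2 * K + 5 ≤ n) (hF : (n : F) ≠ 0)
    (M : Matrix (Option (Fin (K + 1)) ⊕ Fin (n - 2)) (Option (Fin (K + 1)) ⊕ Fin (n - 2))
      (MvPolynomial (Fin n) F))
    (hdeg : ∀ i j, (M i j).totalDegree ≤ 1) (hdet : M.det = ∑ i, X i ^ n)
    (hrow : ∀ j, constantCoeff (M (Sum.inl none) j) = 0)
    (hcol : ∀ i, constantCoeff (M i (Sum.inl none)) = 0)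
    (hD : constantCoeff M.toBlocks₂₂.det ≠ 0) : False := by
  set m := RingHom.ker (constantCoeff : MvPolynomial (Fin n) F →+* F) with hm_def
  have hm : m.IsPrime := RingHom.ker_isPrime _
  set Φ := M.schurNumerator with hΦ
  set δ := M.toBlocks₂₂.det with hδ
  have hδm : δ ∉ m := hD
  have hδ0 : δ ≠ 0 := fun h => hδm (h ▸ m.zero_mem)
  have hdetΦ : Φ.det = δ ^ (K + 1) * ∑ i, X i ^ n := by
    have h := M.det_schurNumerator_mul
    rw [hdet, Fintype.card_option, Fintype.card_fin, pow_succ, ← mul_assoc] at h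
    rw [mul_right_cancel₀ hδ0 h, mul_comm]
  -- The distinguished row has K + 2 entries and the rest of the column K + 1, in total 2K + 3; two
  -- further dimensions account for n ≥ 2K + 5.
  let g : Option (Fin (K + 1)) ⊕ Fin (K + 1) → MvPolynomial (Fin n) F :=
    Sum.elim (fun j => Φ none j) (fun i => Φ (some i) none)
  have hgm : Set.range g ⊆ m := by
    rintro _ ⟨j | i, rfl⟩
    · exact Matrix.schurNumerator_mem_of_row hrow j
    · exact Matrix.schurNumerator_mem_of_col hcol (some i)
  have hcard : (Set.range g).encard ≤ ((2 * K + 3 : ℕ) : ℕ∞) := by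
    rw [← Set.image_univ]
    refine (Set.encard_image_le _ _).trans ?_
    rw [Set.encard_univ, ENat.card_eq_coe_fintype_card]
    simp only [Fintype.card_sum, Fintype.card_option, Fintype.card_fin]
    exact_mod_cast (by omega)
  have hheight : (Set.range g).encard + 2 ≤ m.height := by
    refine (add_le_add_left hcard 2).trans ?_
    refine le_trans ?_ (le_height_ker_constantCoeff (F := F) n)
    exact_mod_cast hn
  obtain ⟨p, q, hp, hq, hgp, hpq, hqm⟩ :=
    Ideal.exists_lt_lt_of_encard_add_two_le_height _ hgm hheight (Set.finite_range g)
  have hrowp : ∀ j, Φ none j ∈ p := fun j => hgp (Ideal.subset_span ⟨Sum.inl j, rfl⟩)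
  have hcolp : ∀ i, Φ i none ∈ p := by
    rintro (_ | i)
    · exact hrowp none
    · exact hgp (Ideal.subset_span ⟨Sum.inr i, rfl⟩)
  have hδp : δ ^ (K + 1) ∉ p := fun h => hδm ((hpq.trans hqm).le (hp.mem_of_pow_mem _ h))
  have hPp : (∑ i : Fin n, (X i : MvPolynomial (Fin n) F) ^ n) ∈ p := by
    have h : Φ.det ∈ p := Matrix.det_mem_of_row_mem hrowp
    rw [hdetΦ] at h
    exact (hp.mem_or_mem h).resolve_left hδp
  refine not_lt_lt_of_mul_X_pow_sub_mem hpq hqm (δ := δ ^ (K + 1) * C (n : F))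
    (ψ := Φ.adjugate none none) (e := n - 1) ?_ (fun i => pderiv i (Φ none none)) (fun i => ?_)
    (fun i => ?_)
  · intro h
    rcases hm.mem_or_mem h with h | h
    · exact hδm (hm.mem_of_pow_mem _ h)
    · exact hF (by simpa [hm_def, RingHom.mem_ker] using h)
  -- The block size n - 2 is chosen for this: Φ has degree at most n - 1, so its derivatives have
  -- degree at most n - 2, below e = n - 1.
  · have h1 := M.totalDegree_schurNumerator_le hdeg (by rw [Fintype.card_fin]; omega) none none
    rw [Fintype.card_fin, ← hΦ] at h1
    have h2 := totalDegree_pderiv_le i (Φ none none)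
    omega
  · have h := Matrix.derivation_det_sub_mem (pderiv i) hrowp hcolp
    rw [hdetΦ, Derivation.leibniz, smul_eq_mul, smul_eq_mul, pderiv_sum_X_pow] at h
    -- Since P lies in `p`, the Leibniz term that differentiates the power of δ drops out.
    have h2 := p.sub_mem h (p.mul_mem_right (pderiv i (δ ^ (K + 1))) hPp)
    convert h2 using 1
    ring

theorem HasDetRep.mono {σ R : Type*} [CommRing R] {P : MvPolynomial σ R} {k m : ℕ}
    (h : HasDetRep P k) (hkm : k ≤ m) : HasDetRep P m := by
  obtain ⟨l, rfl⟩ := Nat.exists_eq_add_of_le hkm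
  obtain ⟨M, hM, hdet⟩ := h
  refine ⟨(Matrix.fromBlocks M 0 0 (1 : Matrix (Fin l) (Fin l) _)).submatrix
    finSumFinEquiv.symm finSumFinEquiv.symm, fun i j => ?_, ?_⟩
  · simp only [Matrix.submatrix_apply]
    rcases finSumFinEquiv.symm i with i | i <;> rcases finSumFinEquiv.symm j with j | j
    · simpa using hM i j
    · simp
    · simp
    · by_cases hij : i = j
      · simp [hij]
      · simp [hij]
  · rw [Matrix.det_submatrix_equiv_self, Matrix.det_fromBlocks_zero₂₁, hdet, Matrix.det_one, mul_one]

theorem totalDegree_mul_map_C_mul_le {σ : Type*} {m : ℕ}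
    (G H : Matrix (Fin m) (Fin m) F) (M : Matrix (Fin m) (Fin m) (MvPolynomial σ F))
    (h : ∀ i j, (M i j).totalDegree ≤ 1) (i j : Fin m) :
    ((G.map C * M * H.map C : Matrix (Fin m) (Fin m) (MvPolynomial σ F)) i j).totalDegree ≤ 1 := by
  rw [Matrix.mul_apply]
  refine totalDegree_finsetSum_le fun k _ => (totalDegree_mul _ _).trans ?_
  rw [Matrix.map_apply, totalDegree_C, add_zero, Matrix.mul_apply]
  refine totalDegree_finsetSum_le fun l _ => (totalDegree_mul _ _).trans ?_
  rw [Matrix.map_apply, totalDegree_C, zero_add]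
  exact h _ _

theorem not_hasDetRep_sum_X_pow {K : ℕ} (hn : 2 * K + 5 ≤ n) (hF : (n : F) ≠ 0) :
    ¬ HasDetRep (∑ i : Fin n, (X i : MvPolynomial (Fin n) F) ^ n) (n + K) := by
  rintro ⟨M, hM, hdet⟩
  obtain ⟨L, L', D, hLD⟩ :=
    Matrix.Pivot.exists_list_transvec_mul_mul_list_transvec_eq_diagonal (M.map constantCoeff)
  set G := (L.map Matrix.TransvectionStruct.toMatrix).prod with hG
  set H := (L'.map Matrix.TransvectionStruct.toMatrix).prod with hH
  have hGdet : G.det = 1 := Matrix.TransvectionStruct.det_toMatrix_prod L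
  have hHdet : H.det = 1 := Matrix.TransvectionStruct.det_toMatrix_prod L'
  let N : Matrix (Fin (n + K)) (Fin (n + K)) (MvPolynomial (Fin n) F) := G.map C * M * H.map C
  have hmapdet (E : Matrix (Fin (n + K)) (Fin (n + K)) F) (hE : E.det = 1) :
      (E.map (C : F →+* MvPolynomial (Fin n) F)).det = 1 := by
    have := RingHom.map_det (C : F →+* MvPolynomial (Fin n) F) E
    rw [hE, map_one] at this
    exact this.symm
  have hNdet : N.det = ∑ i, X i ^ n := by
    rw [Matrix.det_mul, Matrix.det_mul, hmapdet G hGdet, hmapdet H hHdet, hdet, one_mul, mul_one]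
  have hN0 : N.map constantCoeff = Matrix.diagonal D := by
    rw [← hLD, Matrix.map_mul, Matrix.map_mul]
    congr 2 <;> ext i j <;> simp
  have hcc (i j) : constantCoeff (N i j) = Matrix.diagonal D i j := by
    rw [← hN0]
    rfl
  obtain ⟨o, ho⟩ : ∃ o, D o = 0 := by
    have h := RingHom.map_det (constantCoeff : MvPolynomial (Fin n) F →+* F) N
    rw [hNdet] at h
    have h2 : (N.map constantCoeff).det = 0 := by
      refine h.symm.trans ?_
      simp [show n ≠ 0 by omega]
    rw [hN0, Matrix.det_diagonal, Finset.prod_eq_zero_iff] at h2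
    obtain ⟨o, -, ho⟩ := h2
    exact ⟨o, ho⟩
  -- A second zero on the diagonal would make the adjugate at the origin vanish.
  have hne (i) (hi : i ≠ o) : D i ≠ 0 := by
    intro hi0
    refine adjugate_map_constantCoeff_ne_zero (by omega) hF N hNdet ?_
    rw [hN0, Matrix.adjugate_diagonal, Matrix.diagonal_eq_zero]
    funext j
    by_cases hj : j = o
    · subst hj
      exact Finset.prod_eq_zero (Finset.mem_erase.2 ⟨hi, Finset.mem_univ i⟩) hi0
    · exact Finset.prod_eq_zero (Finset.mem_erase.2 ⟨Ne.symm hj, Finset.mem_univ o⟩) ho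
  have hcard : Fintype.card (Option (Fin (K + 1)) ⊕ Fin (n - 2)) =
      Fintype.card (Fin (n + K)) := by
    simp only [Fintype.card_sum, Fintype.card_option, Fintype.card_fin]
    omega
  obtain ⟨e, he⟩ : ∃ e : Option (Fin (K + 1)) ⊕ Fin (n - 2) ≃ Fin (n + K),
      e (Sum.inl none) = o := by
    let e := Fintype.equivOfCardEq hcard
    exact ⟨e.trans (Equiv.swap (e (Sum.inl none)) o), by simp⟩
  refine false_of_det_eq_sum_X_pow hn hF (N.submatrix e e) (fun i j => ?_) ?_ (fun j => ?_)
    (fun i => ?_) ?_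
  · exact totalDegree_mul_map_C_mul_le G H M hM _ _
  · rw [Matrix.det_submatrix_equiv_self, hNdet]
  · rw [Matrix.submatrix_apply, hcc, he, Matrix.diagonal_apply]
    split_ifs
    · exact ho
    · rfl
  · rw [Matrix.submatrix_apply, hcc, he, Matrix.diagonal_apply]
    split_ifs with h
    · rw [h, ho]
    · rfl
  · have h1 : (N.submatrix e e).toBlocks₂₂.map constantCoeff =
        Matrix.diagonal fun i => D (e (Sum.inr i)) := by
      ext i j
      simp [Matrix.toBlocks₂₂, hcc, Matrix.diagonal_apply]
    have h2 := RingHom.map_det (constantCoeff : MvPolynomial (Fin n) F →+* F)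
      (N.submatrix e e).toBlocks₂₂
    rw [h2]
    refine ne_of_eq_of_ne (congrArg Matrix.det h1) ?_
    rw [Matrix.det_diagonal, Finset.prod_ne_zero_iff]
    intro i _
    refine hne _ fun h => ?_
    rw [← he] at h
    simpa using e.injective h

theorem hasDetRep_detComplexity {σ R : Type*} [CommRing R] (P : MvPolynomial σ R) :
    HasDetRep P (detComplexity P) := by
  classical
  exact Nat.find_spec (exists_hasDetRep P)

theorem three_mul_le_of_hasDetRep {m : ℕ} (hn : 5 ≤ n) (hF : (n : F) ≠ 0)
    (h : HasDetRep (∑ i : Fin n, (X i : MvPolynomial (Fin n) F) ^ n) m) : 3 * n ≤ 2 * m + 4 := by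
  by_contra hlt
  -- The subtraction truncates: when m < n, K is 0 and the representation is padded up to size n.
  have hm : m ≤ n + (m - n) := by omega
  exact not_hasDetRep_sum_X_pow (K := m - n) (by omega) hF (h.mono hm)

/-- The determinantal complexity of the power sum of `n` variables of degree `n` is at least
`3 / 2 * n - 2`. -/
theorem le_detComplexity_sum_X_pow (hn : 5 ≤ n) (hF : (n : F) ≠ 0) :
    (3 / 2 : ℝ) * n - 2 ≤
      (detComplexity (∑ i : Fin n, (X i : MvPolynomial (Fin n) F) ^ n) : ℝ) := by
  have h2 := three_mul_le_of_hasDetRep hn hF (hasDetRep_detComplexity _)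
  have h3 : (3 * n : ℝ) ≤
      2 * detComplexity (∑ i : Fin n, (X i : MvPolynomial (Fin n) F) ^ n) + 4 := by
    exact_mod_cast h2
  linarith

end LowerBound

theorem theorem1 :
    (∀ n : ℕ, 6 ≤ n →
      (3 / 2 : ℝ) * n - 3 ≤
        (detComplexity (∑ i : Fin n, (MvPolynomial.X i : MvPolynomial (Fin n) ℂ) ^ n) : ℝ)) ∧
    (∀ (F : Type*) [Field F] [IsAlgClosed F] (p : ℕ) [Fact p.Prime] [CharP F p] (n : ℕ),
      6 ≤ n → ¬ p ∣ n →
      (3 / 2 : ℝ) * n - 3 ≤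
        (detComplexity (∑ i : Fin n, (MvPolynomial.X i : MvPolynomial (Fin n) F) ^ n) : ℝ)) := by
  refine ⟨fun n hn => ?_, fun F _ _ p _ _ n hn hpn => ?_⟩
  · have h0 : (n : ℂ) ≠ 0 := Nat.cast_ne_zero.2 (by omega)
    have := le_detComplexity_sum_X_pow (n := n) (by omega) h0
    linarith
  · have h0 : (n : F) ≠ 0 := fun h => hpn ((CharP.cast_eq_zero_iff F p n).1 h)
    have := le_detComplexity_sum_X_pow (n := n) (by omega) h0
    linarith
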